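/- **Theorem 1.6 (Normal form of effectively one-parametric integrals by quadratures).** Let $I\subset\mathbb R$ be an interval, $x_0\in I$, and $n\ge 1$. *Systems of quadratures.* Let $\varphi_1:I\to\mathbb R$ and $\varphi_j:I\times\mathbb R^{j-1}\to\mathbb R$ $(2\le j\le n)$ be locally integrable on $I$ in the first variable (for each fixed value of the others) and $C^1$ in the other variables (for each fixed value of the first). Put recursively $$s_j(x,c_1,\dots,c_{j-1})=\int_{x_0}^x\varphi_j\bigl(t,\,s_1(t)+c_1,\dots,s_{j-1}(t,c_1,\dots,c_{j-2})+c_{j-1}\bigr)\,dt ,$$ where it is understood that these integrals exist, i.e. that for all $c$ the integrands are locally integrable functions of $t\in I$. The system $(s_1,\dots,s_n)$ is *independent* if there are $c_1,\dots,c_{n-1}\in\mathbb R$ such that $\varphi_1,\varphi_2(\cdot,c_1),\dots,\varphi_n(\cdot,c_1,\dots,c_{n-1})$ are linearly independent as locally integrable functions on $I$, that is, no nontrivial linear combination of them vanishes almost everywhere on $I$. *Integrals by quadratures.* Let $(s_1,\dots,s_n)$ be an independent system of quadratures, let $F:\mathbb R^n\to\mathbb R$ be $C^4$ with $\partial_nF$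 nowhere zero, and let $\Theta:I\times\mathbb R\to\mathbb R$ be $C^1$ in the second variable with $\partial_2\Theta$ nowhere zero. The family $$f(x,c_1,\dots,c_n)=\Theta\bigl(x,F(s_1(x)+c_1,\dots,s_n(x,c_1,\dots,c_{n-1})+c_n)\bigr)\qquad(x\in I,\ c\in\mathbb R^n)$$ is called an *integral by quadratures*. Two families of functions on $I$, with parameters in $\mathbb R^n$ and in $\mathbb R^m$, are *equivalent* if every member of each is identical on $I$ to some member of the other. The family $f$ is *effectively one-parametric* if it is equivalent to a family $g(\cdot,d)$, $d\in\mathbb R$, with $g(x_0,d)=d$ for all $d$. *Claim.* If the integral by quadratures $f$ is effectively one-parametric, then there are locally integrable functions $p,q:I\to\mathbb R$ and a function $\hat\Theta:I\times\mathbb R\to\mathbb R$, $C^1$ in the second variable, such that $f$ is equivalent to the one-parameter family $$\hat f(x,C)=\hat\Theta\left(x,\ \exp\Bigl(-\int_{x_0}^xp\Bigr)\Bigl(\int_{x_0}^xq(t)\exp\Bigl(\int_{x_0}^tp\Bigr)dt+C\Bigr)\right)\qquad(x\in I,\ C\in\mathbb R),$$ and in fact $\hat\Theta(x,c)=\Theta(x,F(0,\dots,0,c))$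 for all $x\in I$, $c\in\mathbb R$. -/

import Mathlib

open MeasureTheory Set

/-- The first `j` entries `(c_1, …, c_j)` of a vector `c`. -/
def initSeg {n : ℕ} (c : Fin n → ℝ) (j : Fin n) : Fin (j : ℕ) → ℝ :=
  fun i => c (Fin.castLE j.2.le i)

/-- The quadratures with integrands `φ`. With `0`-based indices, the `j`-th integrand is a function
`φ j t (c_0, …, c_{j-1})`, and
`s_j(x, c_0, …, c_{j-1}) = ∫_{x₀}^x φ_j(t, s_0(t) + c_0, …, s_{j-1}(t, c_0, …, c_{j-2}) + c_{j-1}) dt`.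
-/
noncomputable def quadrature {n : ℕ} (φ : (j : Fin n) → ℝ → (Fin (j : ℕ) → ℝ) → ℝ) (x₀ : ℝ)
    (j : Fin n) (x : ℝ) (c : Fin (j : ℕ) → ℝ) : ℝ :=
  ∫ t in x₀..x, φ j t
    (fun i => quadrature φ x₀ (Fin.castLE j.2.le i) t (initSeg c i) + c i)
termination_by (j : ℕ)
decreasing_by exact i.2

/-- The point `(s_0(x) + c_0, …, s_{n-1}(x, c_0, …, c_{n-2}) + c_{n-1})` of `ℝⁿ`. -/
noncomputable def quadratureCurve {n : ℕ} (φ : (j : Fin n) → ℝ → (Fin (j : ℕ) → ℝ) → ℝ) (x₀ : ℝ)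
    (c : Fin n → ℝ) (x : ℝ) : Fin n → ℝ :=
  fun j => quadrature φ x₀ j x (initSeg c j) + c j

/-- `φ` is the sequence of integrands of a system of quadratures on the interval `I`:
each `φ_j` is locally integrable in the first variable and continuously differentiable in the
other variables, and the integrals that define the quadratures exist. -/
structure IsQuadratureSystem {n : ℕ} (I : Set ℝ) (x₀ : ℝ)
    (φ : (j : Fin n) → ℝ → (Fin (j : ℕ) → ℝ) → ℝ) : Prop where
  locallyIntegrable : ∀ (j : Fin n) (c : Fin (j : ℕ) → ℝ),
    LocallyIntegrableOn (fun x => φ j x c) I volume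
  contDiff : ∀ (j : Fin n), ∀ x ∈ I, ContDiff ℝ 1 (φ j x)
  integrand_locallyIntegrable : ∀ (j : Fin n) (c : Fin n → ℝ),
    LocallyIntegrableOn (fun t => φ j t (initSeg (quadratureCurve φ x₀ c t) j)) I volume

/-- Independence of a system of quadratures: for some `c`, the functions
`φ_0, φ_1(·, c_0), …, φ_{n-1}(·, c_0, …, c_{n-2})` are linearly independent as locally integrable
functions on `I` (functions that agree almost everywhere are identified). -/
def IndependentQuadratures {n : ℕ} (I : Set ℝ)
    (φ : (j : Fin n) → ℝ → (Fin (j : ℕ) → ℝ) → ℝ) : Prop :=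
  ∃ c : Fin n → ℝ, ∀ a : Fin n → ℝ,
    (∀ᵐ x ∂(volume.restrict I), ∑ j, a j * φ j x (initSeg c j) = 0) → a = 0

/-- Admissible functions: four times continuously differentiable, with a partial derivative
in the last variable that has no zeros. -/
def Admissible {n : ℕ} (F : (Fin (n + 1) → ℝ) → ℝ) : Prop :=
  ContDiff ℝ 4 F ∧ ∀ c, fderiv ℝ F c (Pi.single (Fin.last n) 1) ≠ 0

/-- The family `Θ(x, F(s_0(x) + c_0, …, s_n(x, c_0, …, c_{n-1}) + c_n))`. -/
noncomputable def quadratureIntegral {n : ℕ}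
    (φ : (j : Fin (n + 1)) → ℝ → (Fin (j : ℕ) → ℝ) → ℝ) (x₀ : ℝ)
    (Θ : ℝ → ℝ → ℝ) (F : (Fin (n + 1) → ℝ) → ℝ) (x : ℝ) (c : Fin (n + 1) → ℝ) : ℝ :=
  Θ x (F (quadratureCurve φ x₀ c x))

/-- The data `φ, Θ, F` define an integral by quadratures on `I`. -/
structure IsIntegralByQuadratures {n : ℕ} (I : Set ℝ) (x₀ : ℝ)
    (φ : (j : Fin (n + 1)) → ℝ → (Fin (j : ℕ) → ℝ) → ℝ)
    (Θ : ℝ → ℝ → ℝ) (F : (Fin (n + 1) → ℝ) → ℝ) : Prop where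
  system : IsQuadratureSystem I x₀ φ
  independent : IndependentQuadratures I φ
  contDiff_snd : ∀ x ∈ I, ContDiff ℝ 1 (Θ x)
  deriv_snd_ne_zero : ∀ x ∈ I, ∀ u, deriv (Θ x) u ≠ 0
  admissible : Admissible F

/-- Two parametrized families of functions on `I` are equivalent if they consist of the same
functions on `I`. -/
def EquivalentFamilies {P Q : Type*} (I : Set ℝ) (f : ℝ → P → ℝ) (g : ℝ → Q → ℝ) : Prop :=
  (∀ c, ∃ d, ∀ x ∈ I, f x c = g x d) ∧ (∀ d, ∃ c, ∀ x ∈ I, f x c = g x d)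

/-- A family is effectively one-parametric if it is equivalent to a one-parameter family that is
parametrized by its values at `x₀`. -/
def EffectivelyOneParametric {P : Type*} (I : Set ℝ) (x₀ : ℝ) (f : ℝ → P → ℝ) : Prop :=
  ∃ g : ℝ → ℝ → ℝ, EquivalentFamilies I f g ∧ ∀ d, g x₀ d = d

/-! Members that agree at `x₀` agree on `I`, and `Θ x` is injective, so the triangular maps `c ↦
quadratureCurve φ x₀ c x` send level sets of `F` into level sets. Differentiating in `x` shows that
for almost every `x` the field `X = integrandField φ x` is a level field: `dF(X)` is a function of
`F`. Level fields form a vector space, and independence makes them span the tangent space at some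
point `c`.

Let `e` be the last basis vector and let `ω(w) = dF(w)/dF(e)` be `slopeAlong F w`. Level fields do
not depend on the last variable and satisfy `X(ω(w)) = -ω(DX w)`, where triangularity makes `DX w`
vanish in one entry more than `w`. Induction on these entries, together with the integrability of
`ω`, shows that `ω(w)` is affine in the last variable (`Admissible.slopeAlong_affine`).

Affinity has two consequences. Moving along a ray inside a level set is a linear equation for the
last coordinate, so it can be followed to the origin: every level set meets the last axis, in a
point `V • e`. And along a member of the family, `V' = ω(X)` evaluated at `V • e` is affine in `V`,
that is `V' = q - p V`; variation of constants gives the normal form. -/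

/-- The `w`-derivative of `F` divided by its derivative in the last variable. -/
noncomputable def slopeAlong {n : ℕ} (F : (Fin (n + 1) → ℝ) → ℝ) (w y : Fin (n + 1) → ℝ) : ℝ :=
  fderiv ℝ F y w / fderiv ℝ F y (Pi.single (Fin.last n) 1)

/-- A continuously differentiable triangular vector field along which the derivative of `F`
depends on the value of `F` only. -/
structure IsLevelField {n : ℕ} (F : (Fin (n + 1) → ℝ) → ℝ)
    (X : (Fin (n + 1) → ℝ) → Fin (n + 1) → ℝ) : Prop where
  contDiff : ContDiff ℝ 1 X
  triangular : ∀ (j : Fin (n + 1)) (y z : Fin (n + 1) → ℝ), (∀ i < j, y i = z i) → X y j = X z j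
  level : ∀ y z, F y = F z → fderiv ℝ F y (X y) = fderiv ℝ F z (X z)

/-! ### Triangular level fields. -/

namespace IsLevelField

variable {n : ℕ} {F : (Fin (n + 1) → ℝ) → ℝ} {X Y : (Fin (n + 1) → ℝ) → Fin (n + 1) → ℝ}

theorem zero : IsLevelField F (fun _ => 0) :=
  ⟨contDiff_const, fun _ _ _ _ => rfl, fun _ _ _ => by simp⟩

theorem add (hX : IsLevelField F X) (hY : IsLevelField F Y) :
    IsLevelField F (fun y => X y + Y y) :=
  ⟨hX.contDiff.add hY.contDiff,
    fun j y z h => by simp [hX.triangular j y z h, hY.triangular j y z h],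
    fun y z h => by simp [hX.level y z h, hY.level y z h]⟩

theorem smul (hX : IsLevelField F X) (a : ℝ) : IsLevelField F (fun y => a • X y) :=
  ⟨hX.contDiff.const_smul a,
    fun j y z h => by simp [hX.triangular j y z h],
    fun y z h => by simp [hX.level y z h]⟩

/-- A triangular field does not depend on the last variable. -/
theorem add_single_last (hX : IsLevelField F X) (y : Fin (n + 1) → ℝ) (t : ℝ) :
    X (y + t • Pi.single (Fin.last n) 1) = X y := by
  ext j
  refine hX.triangular j _ _ fun i hi => ?_
  have : i ≠ Fin.last n := (hi.trans_le (Fin.le_last j)).ne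
  simp [Pi.single_eq_of_ne this]

theorem fderiv_add_single_last (hX : IsLevelField F X) (y : Fin (n + 1) → ℝ) (t : ℝ) :
    fderiv ℝ X (y + t • Pi.single (Fin.last n) 1) = fderiv ℝ X y := by
  rw [← fderiv_comp_add_right]
  congr 1
  ext1 z
  exact hX.add_single_last z t

/-- If `w` vanishes in the entries before the `m`-th one, then the derivative of a triangular field
along `w` also vanishes in the `m`-th entry. -/
theorem fderiv_apply_eq_zero (hX : IsLevelField F X) {m : ℕ} {w : Fin (n + 1) → ℝ}
    (hw : ∀ i : Fin (n + 1), (i : ℕ) < m → w i = 0) (y : Fin (n + 1) → ℝ)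
    (j : Fin (n + 1)) (hj : (j : ℕ) < m + 1) : fderiv ℝ X y w j = 0 := by
  have hd : HasFDerivAt X (fderiv ℝ X y) (y + (0 : ℝ) • w) := by
    simpa using (hX.contDiff.differentiable one_ne_zero y).hasFDerivAt
  have hl : HasDerivAt (fun t : ℝ => y + t • w) w 0 := by
    simpa using ((hasDerivAt_id (0 : ℝ)).smul_const w).const_add y
  have h1 : HasDerivAt (fun t : ℝ => X (y + t • w) j) (fderiv ℝ X y w j) 0 :=
    (hasDerivAt_pi.1 (hd.comp_hasDerivAt (0 : ℝ) hl)) j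
  -- Only entries before `j ≤ m` enter the `j`-th component, and `w` does not move them.
  have h2 : (fun t : ℝ => X (y + t • w) j) = fun _ => X y j := by
    ext t
    refine hX.triangular j _ _ fun i hi => ?_
    simp [hw i (by have : (i : ℕ) < j := hi; omega)]
  rw [h2] at h1
  exact h1.unique (hasDerivAt_const _ _)

end IsLevelField

/-! ### The one-form of slopes: integrability and invariance. -/

section Slope

variable {n : ℕ} {F : (Fin (n + 1) → ℝ) → ℝ}

theorem Admissible.contDiff_fderiv (hF : Admissible F) : ContDiff ℝ 1 (fderiv ℝ F) :=
  hF.1.fderiv_right (by norm_num)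

theorem Admissible.differentiable (hF : Admissible F) : Differentiable ℝ F :=
  hF.1.differentiable (by norm_num)

theorem Admissible.hasFDerivAt_fderiv_apply (hF : Admissible F) (y w : Fin (n + 1) → ℝ) :
    HasFDerivAt (fun z => fderiv ℝ F z w) ((fderiv ℝ (fderiv ℝ F) y).flip w) y := by
  have h := ((hF.contDiff_fderiv.differentiable one_ne_zero y).hasFDerivAt).clm_apply
    (hasFDerivAt_const w y)
  rwa [ContinuousLinearMap.comp_zero, zero_add] at h

theorem Admissible.contDiff_slopeAlong (hF : Admissible F) (w : Fin (n + 1) → ℝ) :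
    ContDiff ℝ 1 (slopeAlong F w) :=
  (hF.contDiff_fderiv.clm_apply contDiff_const).div (hF.contDiff_fderiv.clm_apply contDiff_const)
    hF.2

theorem Admissible.fderiv_slopeAlong (hF : Admissible F) (w y v : Fin (n + 1) → ℝ) :
    fderiv ℝ (slopeAlong F w) y v =
      (fderiv ℝ (fderiv ℝ F) y v w * fderiv ℝ F y (Pi.single (Fin.last n) 1) -
        fderiv ℝ F y w * fderiv ℝ (fderiv ℝ F) y v (Pi.single (Fin.last n) 1)) /
        fderiv ℝ F y (Pi.single (Fin.last n) 1) ^ 2 := by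
  have h0 := hF.2 y
  have h := (hF.hasFDerivAt_fderiv_apply y w).mul ((hasDerivAt_inv h0).comp_hasFDerivAt y
    (hF.hasFDerivAt_fderiv_apply y (Pi.single (Fin.last n) 1)))
  have h' : HasFDerivAt (slopeAlong F w) _ y := h
  rw [h'.fderiv]
  simp
  field_simp
  ring

theorem Admissible.second_fderiv_symm (hF : Admissible F) (y v w : Fin (n + 1) → ℝ) :
    fderiv ℝ (fderiv ℝ F) y v w = fderiv ℝ (fderiv ℝ F) y w v :=
  (hF.1.contDiffAt.isSymmSndFDerivAt (by simp; norm_num)) v w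

/-- The one-form with coefficients `slopeAlong F` is integrable. -/
theorem Admissible.slopeAlong_symm (hF : Admissible F) (y v w : Fin (n + 1) → ℝ) :
    fderiv ℝ (slopeAlong F v) y w -
        slopeAlong F w y * fderiv ℝ (slopeAlong F v) y (Pi.single (Fin.last n) 1) =
      fderiv ℝ (slopeAlong F w) y v -
        slopeAlong F v y * fderiv ℝ (slopeAlong F w) y (Pi.single (Fin.last n) 1) := by
  have h := hF.2 y
  rw [hF.fderiv_slopeAlong, hF.fderiv_slopeAlong, hF.fderiv_slopeAlong, hF.fderiv_slopeAlong,
    hF.second_fderiv_symm y w v, hF.second_fderiv_symm y w (Pi.single _ _),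
    hF.second_fderiv_symm y v (Pi.single _ _)]
  unfold slopeAlong
  field_simp
  ring

/-- If the `C¹` function `E` is constant on the level sets of `F`, then its derivative is
proportional to that of `F`. -/
theorem Admissible.fderiv_proportional (hF : Admissible F) {E : (Fin (n + 1) → ℝ) → ℝ}
    (hE : ContDiff ℝ 1 E) (h : ∀ y z, F y = F z → E y = E z) (y : Fin (n + 1) → ℝ) :
    ∃ a : ℝ, fderiv ℝ E y = a • fderiv ℝ F y := by
  -- Constancy makes every point extremal on its level set, so Lagrange multipliers apply.
  have hext : IsLocalExtrOn E {x | F x = F y} y := by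
    refine Or.inl ?_
    filter_upwards [self_mem_nhdsWithin] with z hz
    exact (h z y hz).ge
  obtain ⟨a, b, hab, he⟩ := hext.exists_multipliers_of_hasStrictFDerivAt_1d
    (hF.1.contDiffAt.hasStrictFDerivAt (by norm_num)) (hE.contDiffAt.hasStrictFDerivAt one_ne_zero)
  have hb : b ≠ 0 := by
    rintro rfl
    have := DFunLike.congr_fun he (Pi.single (Fin.last n) 1)
    simp [hF.2 y] at this
    exact hab (by simp [this])
  refine ⟨-(a / b), ?_⟩
  ext v
  have := DFunLike.congr_fun he v
  simp at this ⊢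
  field_simp
  linarith

/-- The one-form with coefficients `slopeAlong F` is invariant under level fields. -/
theorem IsLevelField.fderiv_slopeAlong {X : (Fin (n + 1) → ℝ) → Fin (n + 1) → ℝ}
    (hX : IsLevelField F X) (hF : Admissible F) (w y : Fin (n + 1) → ℝ) :
    fderiv ℝ (slopeAlong F w) y (X y) = -slopeAlong F (fderiv ℝ X y w) y := by
  -- Differentiating `dF(X)` along `w` gives `D²F(w, X) + dF(DX w) = a dF(w)`. Along the last basis
  -- vector the term with `DX` drops out, which determines `a`.
  obtain ⟨a, ha⟩ := hF.fderiv_proportional (hF.contDiff_fderiv.clm_apply hX.contDiff) hX.level y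
  have hd := ((hF.contDiff_fderiv.differentiable one_ne_zero y).hasFDerivAt).clm_apply
    (hX.contDiff.differentiable one_ne_zero y).hasFDerivAt
  rw [hd.fderiv] at ha
  have h0 : fderiv ℝ X y (Pi.single (Fin.last n) 1) = 0 := by
    ext j
    refine hX.fderiv_apply_eq_zero (m := n) (fun i hi => ?_) y j j.2
    rw [Pi.single_eq_of_ne]
    rintro rfl
    simp at hi
  have hw := DFunLike.congr_fun ha w
  have he := DFunLike.congr_fun ha (Pi.single (Fin.last n) 1)
  simp [h0] at hw he
  have h := hF.2 y
  rw [hF.fderiv_slopeAlong, slopeAlong, hF.second_fderiv_symm y (X y) w,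
    hF.second_fderiv_symm y (X y), he]
  field_simp
  linear_combination hw

end Slope

/-! ### Integral curves of triangular fields and transitivity. -/

theorem quadratureCurve_apply {n : ℕ} (φ : (j : Fin n) → ℝ → (Fin (j : ℕ) → ℝ) → ℝ) (x₀ : ℝ)
    (c : Fin n → ℝ) (x : ℝ) (j : Fin n) :
    quadratureCurve φ x₀ c x j =
      (∫ t in x₀..x, φ j t (initSeg (quadratureCurve φ x₀ c t) j)) + c j := by
  rw [quadratureCurve, quadrature]
  rfl

theorem quadratureCurve_self {n : ℕ} (φ : (j : Fin n) → ℝ → (Fin (j : ℕ) → ℝ) → ℝ) (x₀ : ℝ)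
    (c : Fin n → ℝ) : quadratureCurve φ x₀ c x₀ = c := by
  ext j
  simp [quadratureCurve_apply]

/-- A continuous triangular vector field has a global integral curve through every point. -/
theorem exists_integralCurve {n : ℕ} {X : (Fin n → ℝ) → Fin n → ℝ} (hX : Continuous X)
    (htri : ∀ (j : Fin n) (y z : Fin n → ℝ), (∀ i < j, y i = z i) → X y j = X z j)
    (y : Fin n → ℝ) :
    ∃ γ : ℝ → Fin n → ℝ, γ 0 = y ∧ ∀ t, HasDerivAt γ (X (γ t)) t := by
  -- A triangular system is solved entry by entry by integration, so no solution blows up. The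
  -- padding by zeros is never read by the `j`-th component.
  let ext (j : Fin n) (u : Fin (j : ℕ) → ℝ) : Fin n → ℝ :=
    fun i => if h : (i : ℕ) < j then u ⟨i, h⟩ else 0
  let φ : (j : Fin n) → ℝ → (Fin (j : ℕ) → ℝ) → ℝ := fun j _ u => X (ext j u) j
  let γ := quadratureCurve φ 0 y
  have hφ : ∀ j t, φ j t (initSeg (γ t) j) = X (ext j (initSeg (γ t) j)) j := fun _ _ => rfl
  have hφX : ∀ j t, φ j t (initSeg (γ t) j) = X (γ t) j := by
    intro j t
    rw [hφ]
    refine htri j _ _ fun i hi => ?_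
    simp [ext, initSeg, hi]
  have hγ : ∀ j t, γ t j = (∫ s in (0 : ℝ)..t, φ j s (initSeg (γ s) j)) + y j :=
    fun j t => quadratureCurve_apply φ 0 y t j
  have hcont : ∀ m : ℕ, ∀ j : Fin n, (j : ℕ) = m → Continuous fun t => γ t j := by
    intro m
    induction m using Nat.strong_induction_on with
    | _ m ih =>
      intro j hj
      have h1 : Continuous fun t => φ j t (initSeg (γ t) j) := by
        simp only [hφ]
        refine (continuous_apply j).comp (hX.comp (continuous_pi fun i => ?_))
        by_cases h : (i : ℕ) < j
        · simp only [ext, h, dite_true, initSeg]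
          exact ih i (hj ▸ h) _ rfl
        · simp only [ext, h, dite_false]
          exact continuous_const
      simp only [hγ j]
      exact (intervalIntegral.continuous_primitive (fun a b => h1.intervalIntegrable a b) 0).add
        continuous_const
  have hc : Continuous γ := continuous_pi fun j => hcont j j rfl
  refine ⟨γ, quadratureCurve_self φ 0 y, fun t => hasDerivAt_pi.2 fun j => ?_⟩
  have h1 : Continuous fun t => φ j t (initSeg (γ t) j) := by
    simp only [hφX]
    exact (continuous_apply j).comp (hX.comp hc)
  simp only [hγ j]
  rw [← hφX]
  exact (intervalIntegral.integral_hasDerivAt_right (h1.intervalIntegrable 0 t)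
    h1.aestronglyMeasurable.stronglyMeasurableAtFilter h1.continuousAt).add_const _

section Slope

variable {n : ℕ} {F : (Fin (n + 1) → ℝ) → ℝ}

/-- If the level fields span the tangent space at one point, then a function that is constant along
all level fields is constant. -/
theorem eq_of_fderiv_levelField_eq_zero {c : Fin (n + 1) → ℝ}
    (hspan : ∀ v, ∃ X, IsLevelField F X ∧ X c = v) {W : (Fin (n + 1) → ℝ) → ℝ}
    (hW : Differentiable ℝ W) (h : ∀ X, IsLevelField F X → ∀ y, fderiv ℝ W y (X y) = 0)
    (y : Fin (n + 1) → ℝ) : W y = W c := by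
  -- Here `k` counts the trailing entries in which `y` may differ from `c`.
  suffices H : ∀ k : ℕ, k ≤ n + 1 → ∀ y : Fin (n + 1) → ℝ,
      (∀ i : Fin (n + 1), (i : ℕ) < n + 1 - k → y i = c i) → W y = W c from
    H (n + 1) le_rfl y fun i hi => by simp at hi
  intro k
  induction k with
  | zero =>
    intro _ y hy
    rw [show y = c from funext fun i => hy i (by omega)]
  | succ k ih =>
    intro hk y hy
    let j : Fin (n + 1) := ⟨n + 1 - (k + 1), by omega⟩
    -- As long as the entries before `j` equal those of `c`, the components of `X` up to `j` are
    -- those of `X c`. The flow thus fixes the earlier entries and carries the `j`-th one to `c j`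
    -- in unit time; later entries are unrestricted.
    obtain ⟨X, hX, hXc⟩ := hspan (Pi.single j (c j - y j))
    obtain ⟨γ, h0, hγ⟩ := exists_integralCurve hX.contDiff.continuous hX.triangular y
    have hγj : ∀ i t, HasDerivAt (fun t => γ t i) (X (γ t) i) t :=
      fun i t => hasDerivAt_pi.1 (hγ t) i
    have hbelow : ∀ m : ℕ, ∀ i : Fin (n + 1), (i : ℕ) = m → i < j → ∀ t, γ t i = c i := by
      intro m
      induction m using Nat.strong_induction_on with
      | _ m ihm =>
        intro i him hij t
        have hd : ∀ s, HasDerivAt (fun t => γ t i) 0 s := by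
          intro s
          have h1 : X (γ s) i = X c i := hX.triangular i _ _ fun l hl =>
            ihm l (him ▸ hl) l rfl (hl.trans hij) s
          have h2 := hγj i s
          rwa [h1, hXc, Pi.single_eq_of_ne hij.ne] at h2
        have h3 := is_const_of_deriv_eq_zero (fun s => (hd s).differentiableAt)
          (fun s => (hd s).deriv) t 0
        simp only [h0] at h3
        rw [h3]
        exact hy i hij
    have hj : γ 1 j = c j := by
      have hd : ∀ s, HasDerivAt (fun t => γ t j - t * (c j - y j)) 0 s := by
        intro s
        have h1 : X (γ s) j = X c j := hX.triangular j _ _ fun l hl => hbelow l l rfl hl s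
        have h2 := (hγj j s).sub ((hasDerivAt_id s).mul_const (c j - y j))
        rw [h1, hXc, Pi.single_eq_same] at h2
        rw [one_mul, sub_self] at h2
        exact h2
      have h3 := is_const_of_deriv_eq_zero (fun s => (hd s).differentiableAt)
        (fun s => (hd s).deriv) 1 0
      simp only [h0] at h3
      linarith
    have hWγ : ∀ s, HasDerivAt (fun t => W (γ t)) 0 s := by
      intro s
      have := (hW (γ s)).hasFDerivAt.comp_hasDerivAt s (hγ s)
      rwa [h X hX] at this
    have h4 := is_const_of_deriv_eq_zero (fun s => (hWγ s).differentiableAt)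
      (fun s => (hWγ s).deriv) 0 1
    simp only [h0] at h4
    rw [h4]
    refine ih (by omega) _ fun i hi => ?_
    rcases lt_trichotomy i j with hij | hij | hij
    · exact hbelow i i rfl hij 1
    · rw [hij, hj]
    · have h5 : n + 1 - (k + 1) < (i : ℕ) := hij
      omega

end Slope

/-! ### Affinity of the slopes in the last variable. -/

/-- A differentiable solution of Cauchy's functional equation is affine. -/
theorem eq_affine_of_add {f : ℝ → ℝ} (hf : Differentiable ℝ f)
    (h : ∀ s t, f (s + t) + f 0 = f s + f t) (t : ℝ) : f t = f 0 + t * (f 1 - f 0) := by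
  have hd : ∀ s, deriv f s = deriv f 0 := by
    intro s
    have h1 : HasDerivAt (fun u => f (s + u)) (deriv f s) 0 :=
      HasDerivAt.comp_const_add (f := f) s 0 (by simpa using (hf s).hasDerivAt)
    have h2 : (fun u => f (s + u)) = fun u => f u + (f s - f 0) := by
      ext u
      linarith [h s u]
    rw [h2] at h1
    exact h1.unique ((hf 0).hasDerivAt.add_const _)
  have hg : ∀ s, HasDerivAt (fun s => f s - s * deriv f 0) 0 s := by
    intro s
    have := (hf s).hasDerivAt.sub ((hasDerivAt_id s).mul_const (deriv f 0))
    rw [one_mul, hd s, sub_self] at this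
    exact this
  have key := is_const_of_deriv_eq_zero (fun s => (hg s).differentiableAt) (fun s => (hg s).deriv)
  have h1 := key t 0
  have h2 := key 1 0
  have h3 : deriv f 0 = f 1 - f 0 := by linarith
  rw [← h3]
  linarith

theorem hasFDerivAt_second_difference {E : Type*} [NormedAddCommGroup E] [NormedSpace ℝ E]
    {G : E → ℝ} (hG : Differentiable ℝ G) (a b y : E) :
    HasFDerivAt (fun y => G (y + (a + b)) + G y - (G (y + a) + G (y + b)))
      (fderiv ℝ G (y + (a + b)) + fderiv ℝ G y - (fderiv ℝ G (y + a) + fderiv ℝ G (y + b))) y := by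
  have h (v : E) : HasFDerivAt (fun y => G (y + v)) (fderiv ℝ G (y + v)) y :=
    hasFDerivAt_comp_add_right v |>.2 (hG (y + v)).hasFDerivAt
  exact ((h _).add (hG y).hasFDerivAt).sub ((h _).add (h _))

section Slope

variable {n : ℕ} {F : (Fin (n + 1) → ℝ) → ℝ}

theorem hasDerivAt_comp_line {E : Type*} [NormedAddCommGroup E] [NormedSpace ℝ E]
    {G : E → ℝ} (hG : Differentiable ℝ G) (y v : E) (t : ℝ) :
    HasDerivAt (fun s : ℝ => G (y + s • v)) (fderiv ℝ G (y + t • v) v) t := by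
  have := (hG (y + t • v)).hasFDerivAt.comp_hasDerivAt t
    (((hasDerivAt_id t).smul_const v).const_add y)
  rwa [one_smul] at this

theorem Admissible.differentiable_slopeAlong (hF : Admissible F) (w : Fin (n + 1) → ℝ) :
    Differentiable ℝ (slopeAlong F w) :=
  (hF.contDiff_slopeAlong w).differentiable one_ne_zero

theorem Admissible.slopeAlong_affine_of_add (hF : Admissible F) {w e : Fin (n + 1) → ℝ}
    (h : ∀ (y : Fin (n + 1) → ℝ) (s t : ℝ), slopeAlong F w (y + (s • e + t • e)) + slopeAlong F w y =
      slopeAlong F w (y + s • e) + slopeAlong F w (y + t • e)) (y : Fin (n + 1) → ℝ) (t : ℝ) :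
    slopeAlong F w (y + t • e) = slopeAlong F w y +
      t * (slopeAlong F w (y + e) - slopeAlong F w y) := by
  have := eq_affine_of_add (f := fun t : ℝ => slopeAlong F w (y + t • e))
    (fun t => (hasDerivAt_comp_line (hF.differentiable_slopeAlong w) y e t).differentiableAt)
    (fun s t => by simpa [add_smul] using h y s t) t
  simpa using this

/-- If the level fields span the tangent space at one point, then `slopeAlong F` has vanishing
second differences in the last variable. -/
theorem Admissible.slopeAlong_second_difference (hF : Admissible F) {c : Fin (n + 1) → ℝ}
    (hspan : ∀ v, ∃ X, IsLevelField F X ∧ X c = v) (m : ℕ) (hm : m ≤ n + 1)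
    (w : Fin (n + 1) → ℝ) (hw : ∀ i : Fin (n + 1), (i : ℕ) < n + 1 - m → w i = 0)
    (y : Fin (n + 1) → ℝ) (s t : ℝ) :
    slopeAlong F w (y + (s • Pi.single (Fin.last n) 1 + t • Pi.single (Fin.last n) 1)) +
        slopeAlong F w y =
      slopeAlong F w (y + s • Pi.single (Fin.last n) 1) +
        slopeAlong F w (y + t • Pi.single (Fin.last n) 1) := by
  induction m generalizing w y s t with
  | zero =>
    have : w = 0 := funext fun i => hw i (by omega)
    simp [this, slopeAlong]
  | succ m ih =>
    replace ih := ih (by omega)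
    let e : Fin (n + 1) → ℝ := Pi.single (Fin.last n) 1
    change slopeAlong F w (y + (s • e + t • e)) + slopeAlong F w y =
      slopeAlong F w (y + s • e) + slopeAlong F w (y + t • e)
    have hdiff := hF.differentiable_slopeAlong
    have hflow : ∀ X, IsLevelField F X → ∀ (y : Fin (n + 1) → ℝ) (t : ℝ),
        fderiv ℝ (slopeAlong F w) (y + t • e) (X y) =
          -slopeAlong F (fderiv ℝ X y w) (y + t • e) := by
      intro X hX y t
      have := hX.fderiv_slopeAlong hF w (y + t • e)
      rwa [hX.add_single_last, hX.fderiv_add_single_last] at this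
    have hsupp : ∀ X, IsLevelField F X → ∀ (y : Fin (n + 1) → ℝ) (i : Fin (n + 1)),
        (i : ℕ) < n + 1 - m → fderiv ℝ X y w i = 0 := fun X hX y i hi =>
      hX.fderiv_apply_eq_zero hw y i (by omega)
    -- Level fields commute with translation in the last variable, so they map this second
    -- difference to minus that of the slope along `DX w`, which vanishes by induction. Hence it
    -- does not depend on the point.
    have hconst : ∀ (s t : ℝ) (y : Fin (n + 1) → ℝ),
        slopeAlong F w (y + (s • e + t • e)) + slopeAlong F w y -
          (slopeAlong F w (y + s • e) + slopeAlong F w (y + t • e)) =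
        slopeAlong F w (c + (s • e + t • e)) + slopeAlong F w c -
          (slopeAlong F w (c + s • e) + slopeAlong F w (c + t • e)) := by
      intro s t
      refine eq_of_fderiv_levelField_eq_zero hspan
        (fun y => (hasFDerivAt_second_difference (hdiff w) _ _ y).differentiableAt) ?_
      intro X hX y
      rw [(hasFDerivAt_second_difference (hdiff w) _ _ y).fderiv]
      have h0 := hflow X hX y 0
      have h1 := hflow X hX y (s + t)
      have h2 := ih _ (hsupp X hX y) y s t
      simp only [zero_smul, add_zero, add_smul] at h0 h1
      simp only [sub_apply, add_apply, h0, h1,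
        hflow X hX y s, hflow X hX y t]
      linarith
    -- On the line `c + t • e` this field equals `e`, so invariance gives the derivative of the
    -- slope there as an affine function of `t`; the slope is quadratic and `b` measures its failure
    -- to be affine.
    obtain ⟨X, hX, hXc⟩ := hspan e
    set w' := fderiv ℝ X c w with hw'
    set a := slopeAlong F w' c with ha
    set b := slopeAlong F w' (c + e) - a with hb
    have haff : ∀ t : ℝ, slopeAlong F w' (c + t • e) = a + t * b :=
      hF.slopeAlong_affine_of_add (ih _ (hsupp X hX c)) c
    have hg' : ∀ t : ℝ, fderiv ℝ (slopeAlong F w) (c + t • e) e = -(a + t * b) := by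
      intro t
      have := hflow X hX c t
      rwa [hXc, ← hw', haff] at this
    have hg : ∀ t : ℝ, slopeAlong F w (c + t • e) = slopeAlong F w c - a * t - b * (t * t) / 2 := by
      intro t
      have hd : ∀ s : ℝ, HasDerivAt
          (fun s : ℝ => slopeAlong F w (c + s • e) + (a * s + b / 2 * (s * s))) 0 s := by
        intro s
        have h1 := (hasDerivAt_comp_line (hdiff w) c e s).add
          (((hasDerivAt_id s).const_mul a).add
            (((hasDerivAt_id s).mul (hasDerivAt_id s)).const_mul (b / 2)))
        rw [hg' s] at h1
        convert! h1 using 1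
        simp
        ring
      have h2 := is_const_of_deriv_eq_zero (fun s => (hd s).differentiableAt)
        (fun s => (hd s).deriv) t 0
      simp only [zero_smul, add_zero, mul_zero] at h2
      linarith
    have hsecond : ∀ s t : ℝ, slopeAlong F w (c + (s • e + t • e)) + slopeAlong F w c -
        (slopeAlong F w (c + s • e) + slopeAlong F w (c + t • e)) = -b * (s * t) := by
      intro s t
      rw [← add_smul, hg, hg, hg]
      ring
    -- Take second differences of the integrability identity at `t = 0, 1, 2`. Both transversal
    -- derivatives contribute zero, the term with `b` contributes `b²` on the left and `(a + t b)²`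
    -- contributes `2 b²` on the right.
    have hb0 : b = 0 := by
      have hA : fderiv ℝ (slopeAlong F w') (c + ((1 : ℝ) • e + (1 : ℝ) • e)) w +
          fderiv ℝ (slopeAlong F w') c w - (fderiv ℝ (slopeAlong F w') (c + (1 : ℝ) • e) w +
            fderiv ℝ (slopeAlong F w') (c + (1 : ℝ) • e) w) = 0 := by
        have h1 := hasFDerivAt_second_difference (hdiff w') ((1 : ℝ) • e) ((1 : ℝ) • e) c
        have h2 : (fun y => slopeAlong F w' (y + ((1 : ℝ) • e + (1 : ℝ) • e)) + slopeAlong F w' y -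
            (slopeAlong F w' (y + (1 : ℝ) • e) + slopeAlong F w' (y + (1 : ℝ) • e))) =
              fun _ => 0 := by
          ext y
          linarith [ih _ (hsupp X hX c) y 1 1]
        rw [h2] at h1
        simpa using DFunLike.congr_fun (h1.unique (hasFDerivAt_const _ _)) w
      have hB : fderiv ℝ (slopeAlong F w) (c + ((1 : ℝ) • e + (1 : ℝ) • e)) w' +
          fderiv ℝ (slopeAlong F w) c w' - (fderiv ℝ (slopeAlong F w) (c + (1 : ℝ) • e) w' +
            fderiv ℝ (slopeAlong F w) (c + (1 : ℝ) • e) w') = 0 := by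
        have h1 := hasFDerivAt_second_difference (hdiff w) ((1 : ℝ) • e) ((1 : ℝ) • e) c
        rw [funext (hconst 1 1)] at h1
        simpa using DFunLike.congr_fun (h1.unique (hasFDerivAt_const _ _)) w'
      have hslope : ∀ t : ℝ, fderiv ℝ (slopeAlong F w') (c + t • e) e = b := by
        intro t
        have h1 := hasDerivAt_comp_line (hdiff w') c e t
        rw [funext haff] at h1
        have h2 := ((hasDerivAt_id t).mul_const b).const_add a
        rw [one_mul] at h2
        exact h1.unique h2
      have hint : ∀ t : ℝ, fderiv ℝ (slopeAlong F w') (c + t • e) w -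
          slopeAlong F w (c + t • e) * b = fderiv ℝ (slopeAlong F w) (c + t • e) w' +
            (a + t * b) * (a + t * b) := by
        intro t
        have := hF.slopeAlong_symm (c + t • e) w' w
        change _ - _ * fderiv ℝ (slopeAlong F w') (c + t • e) e =
          _ - _ * fderiv ℝ (slopeAlong F w) (c + t • e) e at this
        rw [hslope, hg', haff] at this
        linarith
      have i0 := hint 0
      have i1 := hint 1
      have i2 := hint (1 + 1)
      rw [hg] at i0 i1 i2
      rw [add_smul] at i2
      rw [zero_smul, add_zero] at i0
      have : b * b = 0 := by linarith
      exact mul_self_eq_zero.1 this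
    have h1 := hconst s t y
    rw [hsecond, hb0] at h1
    linarith

/-- If the level fields span the tangent space at one point, then `slopeAlong F` is affine in the
last variable. -/
theorem Admissible.slopeAlong_affine (hF : Admissible F) {c : Fin (n + 1) → ℝ}
    (hspan : ∀ v, ∃ X, IsLevelField F X ∧ X c = v) (w y : Fin (n + 1) → ℝ) (t : ℝ) :
    slopeAlong F w (y + t • Pi.single (Fin.last n) 1) = slopeAlong F w y +
      t * (slopeAlong F w (y + Pi.single (Fin.last n) 1) - slopeAlong F w y) :=
  hF.slopeAlong_affine_of_add
    (hF.slopeAlong_second_difference hspan (n + 1) le_rfl w fun i hi => by omega) y t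

/-! ### Level sets meet the last axis. -/

/-- If `slopeAlong F` is affine in the last variable, then every level set of `F` meets the last
coordinate axis. -/
theorem Admissible.exists_eq_smul_single_last (hF : Admissible F)
    (haff : ∀ (w y : Fin (n + 1) → ℝ) (t : ℝ),
      slopeAlong F w (y + t • Pi.single (Fin.last n) 1) = slopeAlong F w y +
        t * (slopeAlong F w (y + Pi.single (Fin.last n) 1) - slopeAlong F w y))
    (y : Fin (n + 1) → ℝ) : ∃ v : ℝ, F (v • Pi.single (Fin.last n) 1) = F y := by
  let e : Fin (n + 1) → ℝ := Pi.single (Fin.last n) 1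
  let l : ℝ → ℝ := fun τ => slopeAlong F y (τ • y)
  let k : ℝ → ℝ := fun τ => slopeAlong F y (τ • y + e) - slopeAlong F y (τ • y)
  have hs : Continuous (slopeAlong F y) := (hF.contDiff_slopeAlong y).continuous
  have hl : Continuous l := hs.comp (by fun_prop)
  have hk : Continuous k := (hs.comp (by fun_prop)).sub hl
  let K : ℝ → ℝ := fun τ => ∫ u in (1 : ℝ)..τ, k u
  have hK : ∀ τ, HasDerivAt K (k τ) τ := fun τ =>
    intervalIntegral.integral_hasDerivAt_right (hk.intervalIntegrable 1 τ)
      hk.aestronglyMeasurable.stronglyMeasurableAtFilter hk.continuousAt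
  have hKc : Continuous K := continuous_iff_continuousAt.2 fun τ => (hK τ).continuousAt
  have hlK : Continuous fun τ => l τ * Real.exp (K τ) := hl.mul (Real.continuous_exp.comp hKc)
  let M : ℝ → ℝ := fun τ => ∫ u in (1 : ℝ)..τ, l u * Real.exp (K u)
  have hM : ∀ τ, HasDerivAt M (l τ * Real.exp (K τ)) τ := fun τ =>
    intervalIntegral.integral_hasDerivAt_right (hlK.intervalIntegrable 1 τ)
      hlK.aestronglyMeasurable.stronglyMeasurableAtFilter hlK.continuousAt
  -- Staying in the level set over the ray `τ • y` means `z' = -(l + k z)` with `z 1 = 0`. The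
  -- equation is linear, so `z` exists up to `τ = 0`.
  let z : ℝ → ℝ := fun τ => -(Real.exp (-K τ) * M τ)
  have hz : ∀ τ, HasDerivAt z (-(k τ * z τ + l τ)) τ := by
    intro τ
    have h1 := (((hK τ).neg.exp).mul (hM τ)).neg
    refine h1.congr_deriv ?_
    simp only [Pi.neg_apply, z, Real.exp_neg]
    field_simp
  have hγ : ∀ τ, HasDerivAt (fun τ => F (τ • y + z τ • e)) 0 τ := by
    intro τ
    have h1 : HasDerivAt (fun τ => τ • y + z τ • e) (y + (-(k τ * z τ + l τ)) • e) τ := by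
      have := ((hasDerivAt_id τ).smul_const y).add ((hz τ).smul_const e)
      rwa [one_smul] at this
    have h2 := (hF.differentiable (τ • y + z τ • e)).hasFDerivAt.comp_hasDerivAt τ h1
    refine h2.congr_deriv ?_
    have h3 := haff y (τ • y) (z τ)
    have h4 := hF.2 (τ • y + z τ • e)
    change slopeAlong F y (τ • y + z τ • e) = l τ + z τ * k τ at h3
    change fderiv ℝ F (τ • y + z τ • e) e ≠ 0 at h4
    have h5 : fderiv ℝ F (τ • y + z τ • e) y =
        (l τ + z τ * k τ) * fderiv ℝ F (τ • y + z τ • e) e := by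
      rw [← h3]
      change _ = _ / fderiv ℝ F (τ • y + z τ • e) e * _
      field_simp
    rw [map_add, map_smul, h5, smul_eq_mul]
    ring
  have h := is_const_of_deriv_eq_zero (fun τ => (hγ τ).differentiableAt) (fun τ => (hγ τ).deriv) 0 1
  refine ⟨z 0, ?_⟩
  have hz1 : z 1 = 0 := by simp [z, M]
  simpa [hz1] using h

end Slope

/-! ### Level sets and translations in the last variable. -/

theorem exists_contDiffAt_rightInverse {g : ℝ → ℝ} (hg : ContDiff ℝ 1 g) {a : ℝ}
    (ha : deriv g a ≠ 0) :
    ∃ θ : ℝ → ℝ, ContDiffAt ℝ 1 θ (g a) ∧ θ (g a) = a ∧ ∀ᶠ u in nhds (g a), g (θ u) = u := by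
  have hd : HasFDerivAt g
      (ContinuousLinearEquiv.unitsEquivAut ℝ (Units.mk0 _ ha) : ℝ →L[ℝ] ℝ) a := by
    have := (hg.differentiable one_ne_zero a).hasDerivAt.hasFDerivAt
    convert! this using 1
  have hs : HasStrictFDerivAt g
      (ContinuousLinearEquiv.unitsEquivAut ℝ (Units.mk0 _ ha) : ℝ →L[ℝ] ℝ) a :=
    hg.contDiffAt.hasStrictFDerivAt' hd one_ne_zero
  exact ⟨hg.contDiffAt.localInverse hd one_ne_zero, hg.contDiffAt.to_localInverse hd one_ne_zero,
    hg.contDiffAt.localInverse_apply_image hd one_ne_zero, hs.eventually_right_inverse⟩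

theorem injective_of_deriv_ne_zero {g : ℝ → ℝ} (hg : ∀ u, deriv g u ≠ 0) :
    Function.Injective g := by
  have hd : Differentiable ℝ g := fun u => differentiableAt_of_deriv_ne_zero (hg u)
  intro a b hab
  by_contra hne
  wlog h : a < b generalizing a b
  · exact this hab.symm (Ne.symm hne) (lt_of_le_of_ne (not_lt.1 h) (Ne.symm hne))
  obtain ⟨u, -, hu⟩ := exists_deriv_eq_zero h hd.continuous.continuousOn hab
  exact hg u hu

section Slope

variable {n : ℕ} {F : (Fin (n + 1) → ℝ) → ℝ}

theorem Admissible.hasDerivAt_line (hF : Admissible F) (y : Fin (n + 1) → ℝ) (t : ℝ) :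
    HasDerivAt (fun s : ℝ => F (y + s • Pi.single (Fin.last n) 1))
      (fderiv ℝ F (y + t • Pi.single (Fin.last n) 1) (Pi.single (Fin.last n) 1)) t :=
  hasDerivAt_comp_line hF.differentiable y _ t

theorem Admissible.deriv_line_ne_zero (hF : Admissible F) (y : Fin (n + 1) → ℝ) (t : ℝ) :
    deriv (fun s : ℝ => F (y + s • Pi.single (Fin.last n) 1)) t ≠ 0 := by
  rw [(hF.hasDerivAt_line y t).deriv]
  exact hF.2 _

theorem Admissible.contDiff_line (hF : Admissible F) (y : Fin (n + 1) → ℝ) :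
    ContDiff ℝ 1 (fun s : ℝ => F (y + s • Pi.single (Fin.last n) 1)) :=
  (hF.1.of_le (by norm_num)).comp (contDiff_const.add (contDiff_id.smul contDiff_const))

theorem Admissible.injective_line (hF : Admissible F) (y : Fin (n + 1) → ℝ) :
    Function.Injective (fun s : ℝ => F (y + s • Pi.single (Fin.last n) 1)) :=
  injective_of_deriv_ne_zero (hF.deriv_line_ne_zero y)

/-- A map that commutes with translations in the last variable and respects the level sets of `F`
maps different level sets to different level sets. -/
theorem Admissible.eq_of_map_eq (hF : Admissible F)
    {T : (Fin (n + 1) → ℝ) → Fin (n + 1) → ℝ}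
    (hT : ∀ c (t : ℝ), T (c + t • Pi.single (Fin.last n) 1) = T c + t • Pi.single (Fin.last n) 1)
    (hTF : ∀ c d, F c = F d → F (T c) = F (T d)) {c d : Fin (n + 1) → ℝ}
    (h : F (T c) = F (T d)) : F c = F d := by
  -- `G` is the map induced by `T` on values of `F`. Near `F c` it is `u ↦ F (T c + θ u • e)` with
  -- `θ` a local inverse of `F` along the last direction, so its derivative is nonzero, and Rolle's
  -- theorem on the interval `range F` makes it injective.
  let G : ℝ → ℝ := fun u => F (T (Function.invFun F u))
  have hG : ∀ c, G (F c) = F (T c) := fun c => hTF _ _ (Function.invFun_eq ⟨c, rfl⟩)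
  have hd : ∀ c, ∃ a ≠ 0, HasDerivAt G a (F c) := by
    intro c
    obtain ⟨θ, hθ, hθ0, hθr⟩ := exists_contDiffAt_rightInverse (hF.contDiff_line c)
      (hF.deriv_line_ne_zero c 0)
    simp only [zero_smul, add_zero] at hθ hθ0 hθr
    have hθd := (hθ.differentiableAt one_ne_zero).hasDerivAt
    have h1 : HasDerivAt (fun u => F (T c + θ u • Pi.single (Fin.last n) 1)) _ (F c) :=
      HasDerivAt.comp (F c) (h₂ := fun s : ℝ => F (T c + s • Pi.single (Fin.last n) 1))
        (hF.hasDerivAt_line (T c) (θ (F c))) hθd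
    refine ⟨_, mul_ne_zero (hF.2 _) ?_, h1.congr_of_eventuallyEq ?_⟩
    · intro h0
      have h2 : HasDerivAt (fun u => F (c + θ u • Pi.single (Fin.last n) 1)) _ (F c) :=
        HasDerivAt.comp (F c) (h₂ := fun s : ℝ => F (c + s • Pi.single (Fin.last n) 1))
          (hF.hasDerivAt_line c (θ (F c))) hθd
      have h3 := (hasDerivAt_id (F c)).congr_of_eventuallyEq hθr
      have h4 := h2.unique h3
      rw [h0, mul_zero] at h4
      exact zero_ne_one h4
    · filter_upwards [hθr] with u hu
      rw [← hT, ← hG, hu]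
  by_contra hne
  wlog hlt : F c < F d generalizing c d
  · exact this h.symm (Ne.symm hne) (lt_of_le_of_ne (not_lt.1 hlt) (Ne.symm hne))
  have hoc := (isPreconnected_range hF.1.continuous).ordConnected
  have hd' : ∀ u ∈ Icc (F c) (F d), ∃ a ≠ 0, HasDerivAt G a u := by
    intro u hu
    obtain ⟨e, rfl⟩ := hoc.out ⟨c, rfl⟩ ⟨d, rfl⟩ hu
    exact hd e
  obtain ⟨u, hu, hu0⟩ := exists_deriv_eq_zero (f := G) hlt
    (fun u hu => (hd' u hu).choose_spec.2.continuousAt.continuousWithinAt)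
    (by rw [hG, hG, h])
  obtain ⟨a, ha, hau⟩ := hd' u (Ioo_subset_Icc_self hu)
  exact ha (hau.deriv.symm.trans hu0)

/-- `F` is strictly monotone along the last direction, so it crosses the value `F y` near `y` on
each vertical line through a nearby point of `D`. -/
theorem Admissible.mem_closure_level (hF : Admissible F) {D : Set (Fin (n + 1) → ℝ)}
    (hD : Dense D) (hDt : ∀ y ∈ D, ∀ t : ℝ, y + t • Pi.single (Fin.last n) 1 ∈ D)
    (y : Fin (n + 1) → ℝ) : y ∈ closure (D ∩ {z | F z = F y}) := by
  rw [Metric.mem_closure_iff]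
  intro ε hε
  let e : Fin (n + 1) → ℝ := Pi.single (Fin.last n) 1
  have he : ‖e‖ = 1 := by simp [e, Pi.norm_single]
  have hFc := hF.1.continuous
  let η := ε / 2
  have hη : 0 < η := half_pos hε
  have hneg : (F (y + (-η) • e) - F y) * (F (y + η • e) - F y) < 0 := by
    have hy : F (y + (0 : ℝ) • e) = F y := by simp
    rcases (hF.contDiff_line y).continuous.strictMono_of_inj (hF.injective_line y) with hm | hm
    · have h1 : F (y + (-η) • e) < F (y + (0 : ℝ) • e) := hm (neg_lt_zero.2 hη)
      have h2 : F (y + (0 : ℝ) • e) < F (y + η • e) := hm hη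
      rw [hy] at h1 h2
      exact mul_neg_of_neg_of_pos (sub_neg.2 h1) (sub_pos.2 h2)
    · have h1 : F (y + (0 : ℝ) • e) < F (y + (-η) • e) := hm (neg_lt_zero.2 hη)
      have h2 : F (y + η • e) < F (y + (0 : ℝ) • e) := hm hη
      rw [hy] at h1 h2
      exact mul_neg_of_pos_of_neg (sub_pos.2 h1) (sub_neg.2 h2)
  have hopen : IsOpen ({z | (F (z + (-η) • e) - F y) * (F (z + η • e) - F y) < 0} ∩
      Metric.ball y η) :=
    (isOpen_lt (by fun_prop) continuous_const).inter Metric.isOpen_ball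
  obtain ⟨z, ⟨hz, hzy⟩, hzD⟩ := hD.inter_open_nonempty _ hopen
    ⟨y, hneg, Metric.mem_ball_self hη⟩
  have hu : F y ∈ uIcc (F (z + (-η) • e)) (F (z + η • e)) := by
    have hz' : (F (z + (-η) • e) - F y) * (F (z + η • e) - F y) < 0 := hz
    rcases mul_neg_iff.1 hz' with ⟨h1, h2⟩ | ⟨h1, h2⟩
    · exact mem_uIcc.2 (Or.inr ⟨by linarith, by linarith⟩)
    · exact mem_uIcc.2 (Or.inl ⟨by linarith, by linarith⟩)
  obtain ⟨t, ht, hFt⟩ := intermediate_value_uIcc (f := fun s : ℝ => F (z + s • e))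
    (hF.contDiff_line z).continuous.continuousOn hu
  rw [uIcc_of_le (by linarith)] at ht
  refine ⟨z + t • e, ⟨hDt z hzD t, hFt⟩, ?_⟩
  have h1 : dist y z < η := by rwa [dist_comm]
  have h2 : dist z (z + t • e) ≤ η := by
    rw [dist_self_add_right, norm_smul, he, mul_one, Real.norm_eq_abs]
    exact abs_le.2 ht
  have := dist_triangle y z (z + t • e)
  have : η + η = ε := add_halves ε
  linarith

theorem Admissible.eq_on_level_of_dense (hF : Admissible F) {D : Set (Fin (n + 1) → ℝ)}
    (hD : Dense D) (hDt : ∀ y ∈ D, ∀ t : ℝ, y + t • Pi.single (Fin.last n) 1 ∈ D)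
    {E : (Fin (n + 1) → ℝ) → ℝ} (hE : Continuous E)
    (h : ∀ y ∈ D, ∀ z ∈ D, F y = F z → E y = E z) (y z : Fin (n + 1) → ℝ) (hyz : F y = F z) :
    E y = E z := by
  have hmem : (y, z) ∈ closure ((D ∩ {x | F x = F y}) ×ˢ (D ∩ {x | F x = F z})) := by
    rw [closure_prod_eq]
    exact ⟨hF.mem_closure_level hD hDt y, hF.mem_closure_level hD hDt z⟩
  have hclosed : IsClosed {p : (Fin (n + 1) → ℝ) × (Fin (n + 1) → ℝ) | E p.1 = E p.2} :=
    isClosed_eq (hE.comp continuous_fst) (hE.comp continuous_snd)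
  refine closure_minimal ?_ hclosed hmem
  rintro ⟨p, q⟩ ⟨⟨hp, hp'⟩, hq, hq'⟩
  exact h p hp q hq (hp'.trans (hyz.trans hq'.symm))

/-- If every level set of `F` meets the last coordinate axis, then the point of intersection
depends continuously differentiably on the level set. -/
theorem Admissible.exists_axis_coordinate (hF : Admissible F)
    (h : ∀ y, ∃ v : ℝ, F (v • Pi.single (Fin.last n) 1) = F y) :
    ∃ V : (Fin (n + 1) → ℝ) → ℝ, ContDiff ℝ 1 V ∧
      (∀ y, F (V y • Pi.single (Fin.last n) 1) = F y) ∧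
      (∀ v : ℝ, V (v • Pi.single (Fin.last n) 1) = v) ∧
      ∀ y w, fderiv ℝ V y w * fderiv ℝ F (V y • Pi.single (Fin.last n) 1)
        (Pi.single (Fin.last n) 1) = fderiv ℝ F y w := by
  choose V hV using h
  have hinj : Function.Injective (fun s : ℝ => F (s • Pi.single (Fin.last n) 1)) := by
    simpa using hF.injective_line 0
  have hVc : ContDiff ℝ 1 V := by
    rw [contDiff_iff_contDiffAt]
    intro y
    obtain ⟨θ, hθ, hθ0, hθr⟩ := exists_contDiffAt_rightInverse (hF.contDiff_line 0)
      (hF.deriv_line_ne_zero 0 (V y))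
    simp only [zero_add, hV] at hθ hθ0 hθr
    have h1 : ContDiffAt ℝ 1 (fun z => θ (F z)) y :=
      ContDiffAt.comp y hθ (hF.1.contDiffAt.of_le (by norm_num))
    refine h1.congr_of_eventuallyEq ?_
    filter_upwards [hF.1.continuous.continuousAt.eventually hθr] with z hz
    exact hinj ((hV z).trans hz.symm)
  refine ⟨V, hVc, hV, fun v => hinj (hV _), fun y w => ?_⟩
  have h1 := (hVc.differentiable one_ne_zero y).hasFDerivAt
  have h2 := hF.hasDerivAt_line 0 (V y)
  simp only [zero_add] at h2
  have h3 := h2.comp_hasFDerivAt y h1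
  have h4 : ((fun s : ℝ => F (s • Pi.single (Fin.last n) 1)) ∘ V) = F := funext hV
  rw [h4] at h3
  rw [h3.fderiv]
  simp [mul_comm]

end Slope

/-! ### Differentiating the quadratures. -/

theorem intervalIntegrable_of_locallyIntegrableOn {I : Set ℝ} (hI : I.OrdConnected) {g : ℝ → ℝ}
    (hg : LocallyIntegrableOn g I volume) {a b : ℝ} (ha : a ∈ I) (hb : b ∈ I) :
    IntervalIntegrable g volume a b :=
  (hg.integrableOn_compact_subset (hI.uIcc_subset ha hb) isCompact_uIcc).intervalIntegrable

theorem ae_mem_interior {I : Set ℝ} (hI : I.OrdConnected) :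
    ∀ᵐ x ∂(volume.restrict I), x ∈ interior I := by
  rw [ae_restrict_iff' hI.measurableSet, ae_iff]
  refine measure_mono_null (fun x hx => ?_) (hI.convex.addHaar_frontier volume)
  have hx' : ¬(x ∈ I → x ∈ interior I) := hx
  rw [Classical.not_imp] at hx'
  exact ⟨subset_closure hx'.1, hx'.2⟩

/-- The Lebesgue differentiation theorem for functions that are locally integrable on an
interval. -/
theorem ae_hasDerivAt_integral_of_locallyIntegrableOn {I : Set ℝ} (hI : I.OrdConnected) {x₀ : ℝ}
    (hx₀ : x₀ ∈ I) {g : ℝ → ℝ} (hg : LocallyIntegrableOn g I volume) :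
    ∀ᵐ x ∂(volume.restrict I), HasDerivAt (fun x => ∫ t in x₀..x, g t) (g x) x := by
  -- Rational endpoints exhaust the interior of `I` with countably many null sets.
  have h1 : ∀ᵐ x ∂(volume : Measure ℝ), ∀ p : ℚ, (p : ℝ) ∈ I → x ∈ uIcc x₀ (p : ℝ) →
      HasDerivAt (fun x => ∫ t in x₀..x, g t) (g x) x := by
    rw [ae_all_iff]
    intro p
    by_cases hp : (p : ℝ) ∈ I
    · filter_upwards [(intervalIntegrable_of_locallyIntegrableOn hI hg hx₀ hp).ae_hasDerivAt_integral]
        with x hx _ hxp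
      exact hx hxp x₀ left_mem_uIcc
    · exact Filter.Eventually.of_forall fun x h => absurd h hp
  filter_upwards [ae_restrict_of_ae h1, ae_mem_interior hI] with x hx hxI
  obtain ⟨ε, hε, hball⟩ := Metric.mem_nhds_iff.1 (mem_interior_iff_mem_nhds.1 hxI)
  rw [Real.ball_eq_Ioo] at hball
  rcases le_total x₀ x with h | h
  · obtain ⟨p, hp1, hp2⟩ := exists_rat_btwn (lt_add_of_pos_right x hε)
    exact hx p (hball ⟨by linarith, hp2⟩) (mem_uIcc.2 (Or.inl ⟨h, hp1.le⟩))
  · obtain ⟨p, hp1, hp2⟩ := exists_rat_btwn (sub_lt_self x hε)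
    exact hx p (hball ⟨hp1, by linarith⟩) (mem_uIcc.2 (Or.inr ⟨hp2.le, h⟩))

/-- The integrands of a system of quadratures at `x`, as a vector field. -/
def integrandField {n : ℕ} (φ : (j : Fin n) → ℝ → (Fin (j : ℕ) → ℝ) → ℝ) (x : ℝ)
    (y : Fin n → ℝ) : Fin n → ℝ :=
  fun j => φ j x (initSeg y j)

theorem initSeg_congr {n : ℕ} {c d : Fin n → ℝ} {j : Fin n} (h : ∀ i < j, c i = d i) :
    initSeg c j = initSeg d j :=
  funext fun i => h _ i.2

theorem contDiff_integrandField {n : ℕ} {I : Set ℝ} {x₀ : ℝ}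
    {φ : (j : Fin n) → ℝ → (Fin (j : ℕ) → ℝ) → ℝ} (h : IsQuadratureSystem I x₀ φ) {x : ℝ}
    (hx : x ∈ I) : ContDiff ℝ 1 (integrandField φ x) :=
  contDiff_pi.2 fun j => (h.contDiff j x hx).comp
    (contDiff_pi.2 fun i => contDiff_apply ℝ ℝ (Fin.castLE j.2.le i))

section Quadrature

variable {n : ℕ} {I : Set ℝ} {x₀ : ℝ} {φ : (j : Fin (n + 1)) → ℝ → (Fin (j : ℕ) → ℝ) → ℝ}

/-- The integral part of an entry involves only the earlier constants. -/
theorem quadratureCurve_sub_eq {c d : Fin (n + 1) → ℝ} {j : Fin (n + 1)}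
    (h : ∀ i < j, c i = d i) (x : ℝ) :
    quadratureCurve φ x₀ c x j - c j = quadratureCurve φ x₀ d x j - d j := by
  unfold quadratureCurve
  rw [initSeg_congr h]
  ring

theorem quadratureCurve_add_smul_single_last (c : Fin (n + 1) → ℝ) (t x : ℝ) :
    quadratureCurve φ x₀ (c + t • Pi.single (Fin.last n) 1) x =
      quadratureCurve φ x₀ c x + t • Pi.single (Fin.last n) 1 := by
  ext j
  have := quadratureCurve_sub_eq (φ := φ) (x₀ := x₀) (c := c + t • Pi.single (Fin.last n) 1)
    (d := c) (j := j) (fun i hi => by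
      have : i ≠ Fin.last n := (hi.trans_le (Fin.le_last j)).ne
      simp [Pi.single_eq_of_ne this]) x
  simp only [Pi.add_apply] at this ⊢
  linarith

/-- For every `x`, the values of the quadratures with rational constants are dense. -/
theorem dense_range_quadratureCurve (x : ℝ) :
    Dense (range fun q : Fin (n + 1) → ℚ => quadratureCurve φ x₀ (fun i => (q i : ℝ)) x) := by
  intro y
  rw [Metric.mem_closure_range_iff]
  intro ε hε
  suffices H : ∀ m : ℕ, ∃ q : Fin (n + 1) → ℚ, ∀ j : Fin (n + 1), (j : ℕ) < m →
      dist (y j) (quadratureCurve φ x₀ (fun i => (q i : ℝ)) x j) < ε by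
    obtain ⟨q, hq⟩ := H (n + 1)
    exact ⟨q, (dist_pi_lt_iff hε).2 fun j => hq j j.2⟩
  intro m
  induction m with
  | zero => exact ⟨0, fun j hj => absurd hj (Nat.not_lt_zero _)⟩
  | succ m ih =>
    obtain ⟨q, hq⟩ := ih
    by_cases hm : m < n + 1
    · let k : Fin (n + 1) := ⟨m, hm⟩
      -- The integral part `s` is already fixed by the earlier constants, so a rational `r` close to
      -- `y k - s` can be chosen next.
      let s := quadratureCurve φ x₀ (fun i => (q i : ℝ)) x k - q k
      obtain ⟨r, hr1, hr2⟩ := exists_rat_btwn (show y k - s - ε < y k - s by linarith)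
      refine ⟨Function.update q k r, fun j hj => ?_⟩
      have hlt : ∀ i < j, ((Function.update q k r i : ℚ) : ℝ) = q i := by
        intro i hi
        have hi' : (i : ℕ) < j := hi
        rw [Function.update_of_ne]
        rintro rfl
        simp only [k] at hi'
        omega
      have h1 := quadratureCurve_sub_eq (φ := φ) (x₀ := x₀) hlt x
      rcases Nat.lt_succ_iff_lt_or_eq.1 hj with hj | hj
      · have hjk : j ≠ k := by
          rintro rfl
          simp [k] at hj
        simp only [Function.update_of_ne hjk, sub_left_inj] at h1
        rw [h1]
        exact hq j hj
      · obtain rfl : j = k := Fin.ext hj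
        simp only [Function.update_self] at h1
        rw [Real.dist_eq, abs_lt]
        constructor <;> linarith
    · exact ⟨q, fun j hj => hq j (by omega)⟩

theorem IsQuadratureSystem.ae_hasDerivAt (hsys : IsQuadratureSystem I x₀ φ)
    (hI : I.OrdConnected) (hx₀ : x₀ ∈ I) (c : Fin (n + 1) → ℝ) :
    ∀ᵐ x ∂(volume.restrict I),
      HasDerivAt (quadratureCurve φ x₀ c) (integrandField φ x (quadratureCurve φ x₀ c x)) x := by
  have h : ∀ᵐ x ∂(volume.restrict I), ∀ j, HasDerivAt
      (fun x => ∫ t in x₀..x, φ j t (initSeg (quadratureCurve φ x₀ c t) j))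
      (φ j x (initSeg (quadratureCurve φ x₀ c x) j)) x :=
    ae_all_iff.2 fun j => ae_hasDerivAt_integral_of_locallyIntegrableOn hI hx₀
      (hsys.integrand_locallyIntegrable j c)
  filter_upwards [h] with x hx
  refine hasDerivAt_pi.2 fun j => ?_
  simp only [quadratureCurve_apply]
  exact (hx j).add_const _

/-- If the level sets of `F` are preserved by the quadratures, then they are preserved
infinitesimally by the integrands. -/
theorem IsQuadratureSystem.ae_level (hsys : IsQuadratureSystem I x₀ φ)
    (hI : I.OrdConnected) (hx₀ : x₀ ∈ I) {F : (Fin (n + 1) → ℝ) → ℝ} (hF : Admissible F)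
    (hlevel : ∀ x ∈ I, ∀ c d, F c = F d →
      F (quadratureCurve φ x₀ c x) = F (quadratureCurve φ x₀ d x)) :
    ∀ᵐ x ∂(volume.restrict I), IsLevelField F (integrandField φ x) := by
  let e : Fin (n + 1) → ℝ := Pi.single (Fin.last n) 1
  -- The exceptional null set depends on the constants; rational ones give a common null set, and
  -- density recovers the other points.
  have h1 : ∀ᵐ x ∂(volume.restrict I), ∀ q : Fin (n + 1) → ℚ,
      HasDerivAt (quadratureCurve φ x₀ fun i => (q i : ℝ))
        (integrandField φ x (quadratureCurve φ x₀ (fun i => (q i : ℝ)) x)) x :=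
    ae_all_iff.2 fun q => hsys.ae_hasDerivAt hI hx₀ _
  filter_upwards [h1, ae_mem_interior hI] with x hx hxI
  have hxI' : x ∈ I := interior_subset hxI
  have hcd := contDiff_integrandField hsys hxI'
  have htri : ∀ (j : Fin (n + 1)) (y z : Fin (n + 1) → ℝ), (∀ i < j, y i = z i) →
      integrandField φ x y j = integrandField φ x z j := fun j y z h => by
    simp only [integrandField, initSeg_congr h]
  refine ⟨hcd, htri, ?_⟩
  have hadd : ∀ (y : Fin (n + 1) → ℝ) (t : ℝ),
      integrandField φ x (y + t • e) = integrandField φ x y := by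
    intro y t
    ext j
    refine htri j _ _ fun i hi => ?_
    have : i ≠ Fin.last n := (hi.trans_le (Fin.le_last j)).ne
    simp [e, Pi.single_eq_of_ne this]
  let S : (Fin (n + 1) → ℚ) → ℝ → Fin (n + 1) → ℝ := fun q => quadratureCurve φ x₀ fun i => (q i : ℝ)
  refine hF.eq_on_level_of_dense (D := {y | ∃ q, ∃ t : ℝ, y = S q x + t • e}) ?_ ?_
    (hF.contDiff_fderiv.clm_apply hcd).continuous ?_
  · refine (dense_range_quadratureCurve (φ := φ) (x₀ := x₀) x).mono ?_
    rintro _ ⟨q, rfl⟩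
    exact ⟨q, 0, by simp [S]⟩
  · rintro _ ⟨q, t, rfl⟩ s
    exact ⟨q, t + s, by rw [add_smul, add_assoc]⟩
  · rintro _ ⟨q, t, rfl⟩ _ ⟨r, s, rfl⟩ h
    have hd : ∀ q (t : ℝ), HasDerivAt (fun x => F (S q x + t • e))
        (fderiv ℝ F (S q x + t • e) (integrandField φ x (S q x + t • e))) x := by
      intro q t
      rw [hadd]
      exact (hF.differentiable _).hasFDerivAt.comp_hasDerivAt x ((hx q).add_const _)
    have hS : ∀ q (t x : ℝ), S q x + t • e =
        quadratureCurve φ x₀ ((fun i => (q i : ℝ)) + t • e) x :=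
      fun q t x => (quadratureCurve_add_smul_single_last _ t x).symm
    -- Equality of levels at `x` is pulled back to the constants and then pushed to all nearby
    -- times, so the two functions of time coincide near `x` and have equal derivatives.
    have h0 : F ((fun i => (q i : ℝ)) + t • e) = F ((fun i => (r i : ℝ)) + s • e) := by
      refine hF.eq_of_map_eq (T := fun c => quadratureCurve φ x₀ c x)
        (fun c t => quadratureCurve_add_smul_single_last c t x) (hlevel x hxI') ?_
      rw [hS, hS] at h
      exact h
    refine ((hd q t).congr_of_eventuallyEq ?_).unique (hd r s)
    filter_upwards [mem_interior_iff_mem_nhds.1 hxI] with u hu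
    rw [hS, hS]
    exact hlevel u hu _ _ h0.symm

/-- For an independent system, the level fields span the tangent space at some point. -/
theorem IndependentQuadratures.exists_levelField_apply_eq (hind : IndependentQuadratures I φ)
    {F : (Fin (n + 1) → ℝ) → ℝ}
    (h : ∀ᵐ x ∂(volume.restrict I), IsLevelField F (integrandField φ x)) :
    ∃ c : Fin (n + 1) → ℝ, ∀ v, ∃ X, IsLevelField F X ∧ X c = v := by
  obtain ⟨c, hc⟩ := hind
  let P : Submodule ℝ (Fin (n + 1) → ℝ) :=
    { carrier := {v | ∃ X, IsLevelField F X ∧ X c = v}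
      add_mem' := by
        rintro _ _ ⟨X, hX, rfl⟩ ⟨Y, hY, rfl⟩
        exact ⟨_, hX.add hY, rfl⟩
      zero_mem' := ⟨_, IsLevelField.zero, rfl⟩
      smul_mem' := by
        rintro a _ ⟨X, hX, rfl⟩
        exact ⟨_, hX.smul a, rfl⟩ }
  have hP : P = ⊤ := by
    by_contra hne
    -- A functional vanishing on a proper subspace `P` would be a linear relation between the
    -- integrands at `c`.
    obtain ⟨f, hf, hPf⟩ := Submodule.exists_le_ker_of_lt_top P (lt_top_iff_ne_top.2 hne)
    have hfsum : ∀ v, f v = ∑ j, f (Pi.single j 1) * v j := by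
      intro v
      conv_lhs => rw [← Finset.univ_sum_single v, map_sum]
      refine Finset.sum_congr rfl fun j _ => ?_
      rw [show (Pi.single j (v j) : Fin (n + 1) → ℝ) = v j • Pi.single j 1 by
        rw [← Pi.single_smul, smul_eq_mul, mul_one], map_smul, smul_eq_mul, mul_comm]
    have h0 := hc (fun j => f (Pi.single j 1)) (by
      filter_upwards [h] with x hx
      have h1 : f (integrandField φ x c) = 0 := hPf ⟨_, hx, rfl⟩
      rwa [hfsum] at h1)
    refine hf (LinearMap.ext fun v => ?_)
    rw [hfsum]
    simp [fun j => congrFun h0 j]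
  exact ⟨c, fun v => (hP ▸ Submodule.mem_top : v ∈ P)⟩

end Quadrature

/-! ### Absolute continuity and the linear equation. -/

theorem absolutelyContinuousOnInterval_pi {ι : Type*} [Fintype ι] {γ : ℝ → ι → ℝ} {a b : ℝ}
    (h : ∀ i, AbsolutelyContinuousOnInterval (fun x => γ x i) a b) :
    AbsolutelyContinuousOnInterval γ a b := by
  have h1 := tendsto_finsetSum Finset.univ fun i _ => h i
  rw [Finset.sum_const_zero] at h1
  refine squeeze_zero (fun E => Finset.sum_nonneg fun _ _ => dist_nonneg) (fun E => ?_) h1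
  rw [Finset.sum_comm]
  refine Finset.sum_le_sum fun k _ => ?_
  refine (dist_pi_le_iff (Finset.sum_nonneg fun _ _ => dist_nonneg)).2 fun i => ?_
  exact Finset.single_le_sum (f := fun i => dist (γ (E.2 k).1 i) (γ (E.2 k).2 i))
    (fun _ _ => dist_nonneg) (Finset.mem_univ i)

/-- The composition of a continuously differentiable function with an absolutely continuous
one is absolutely continuous. -/
theorem ContDiff.comp_absolutelyContinuousOnInterval {E : Type*} [NormedAddCommGroup E]
    [NormedSpace ℝ E] [ProperSpace E] {V : E → ℝ} (hV : ContDiff ℝ 1 V) {γ : ℝ → E} {a b : ℝ}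
    (hγ : AbsolutelyContinuousOnInterval γ a b) :
    AbsolutelyContinuousOnInterval (fun x => V (γ x)) a b := by
  have hγ' := hγ
  obtain ⟨R, hR⟩ := ((isCompact_uIcc (a := a) (b := b)).image_of_continuousOn
    hγ.continuousOn).isBounded.subset_closedBall (0 : E)
  obtain ⟨K, hK⟩ := (hV.contDiffOn (s := Metric.closedBall (0 : E) R)).exists_lipschitzOnWith
    one_ne_zero (convex_closedBall _ _) (isCompact_closedBall _ _)
  rw [absolutelyContinuousOnInterval_iff] at hγ' ⊢
  intro ε hε
  obtain ⟨δ, hδ, h⟩ := hγ' (ε / (K + 1)) (by positivity)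
  refine ⟨δ, hδ, fun J hJ hJδ => ?_⟩
  have hmem := hJ.1
  have h1 := h J hJ hJδ
  rw [lt_div_iff₀ (by positivity)] at h1
  refine lt_of_le_of_lt ?_ h1
  rw [Finset.sum_mul]
  refine Finset.sum_le_sum fun i hi => ?_
  have h2 := hK.dist_le_mul _ (hR ⟨_, (hmem i hi).1, rfl⟩) _ (hR ⟨_, (hmem i hi).2, rfl⟩)
  have h3 : 0 ≤ Dist.dist (γ (J.2 i).1) (γ (J.2 i).2) := dist_nonneg
  linarith

/-- An absolutely continuous solution of `v' = q - p v` is given by the formula of variation of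
constants. -/
theorem eq_variation_of_constants {p q v : ℝ → ℝ} {a b : ℝ}
    (hp : IntervalIntegrable p volume a b) (hq : IntervalIntegrable q volume a b)
    (hv : AbsolutelyContinuousOnInterval v a b)
    (h : ∀ᵐ x, x ∈ uIcc a b → HasDerivAt v (q x - p x * v x) x) :
    v b = Real.exp (-∫ t in a..b, p t) *
      ((∫ t in a..b, q t * Real.exp (∫ r in a..t, p r)) + v a) := by
  let P : ℝ → ℝ := fun x => ∫ t in a..x, p t
  have hP : AbsolutelyContinuousOnInterval P a b :=
    hp.absolutelyContinuousOnInterval_intervalIntegral left_mem_uIcc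
  have hexp : AbsolutelyContinuousOnInterval (fun x => Real.exp (P x)) a b :=
    Real.contDiff_exp.comp_absolutelyContinuousOnInterval hP
  have hqP : IntervalIntegrable (fun t => q t * Real.exp (P t)) volume a b :=
    hq.mul_continuousOn hexp.continuousOn
  -- With the integrating factor, `v exp P - ∫ q exp P` has derivative zero almost everywhere;
  -- absolute continuity makes it constant.
  have hW := (hv.mul hexp).sub
    (hqP.absolutelyContinuousOnInterval_intervalIntegral left_mem_uIcc)
  obtain ⟨C, hC⟩ := hW.const_of_ae_hasDerivAt_zero (by
    filter_upwards [h, hp.ae_hasDerivAt_integral, hqP.ae_hasDerivAt_integral] with x h1 h2 h3 hx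
    have hd := ((h1 hx).mul (h2 hx a left_mem_uIcc).exp).sub (h3 hx a left_mem_uIcc)
    convert! hd using 1
    simp only [P]
    ring)
  have ha := hC a left_mem_uIcc
  have hb := hC b right_mem_uIcc
  simp only [Pi.sub_apply, Pi.mul_apply, P, intervalIntegral.integral_same, Real.exp_zero,
    mul_one, sub_zero] at ha hb
  rw [ha, ← hb, Real.exp_neg]
  field_simp
  ring

theorem slopeAlong_eq_sum {n : ℕ} (F : (Fin (n + 1) → ℝ) → ℝ) (w y : Fin (n + 1) → ℝ) :
    slopeAlong F w y = ∑ j, w j * slopeAlong F (Pi.single j 1) y := by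
  have h : fderiv ℝ F y w = ∑ j, w j * fderiv ℝ F y (Pi.single j 1) := by
    conv_lhs => rw [← Finset.univ_sum_single w, map_sum]
    refine Finset.sum_congr rfl fun j _ => ?_
    rw [show (Pi.single j (w j) : Fin (n + 1) → ℝ) = w j • Pi.single j 1 by
      rw [← Pi.single_smul, smul_eq_mul, mul_one], map_smul, smul_eq_mul]
  simp only [slopeAlong, h, Finset.sum_div, mul_div_assoc]

section Quadrature

variable {n : ℕ} {I : Set ℝ} {x₀ : ℝ} {φ : (j : Fin (n + 1)) → ℝ → (Fin (j : ℕ) → ℝ) → ℝ}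

theorem IsQuadratureSystem.locallyIntegrableOn_slopeAlong (hsys : IsQuadratureSystem I x₀ φ)
    (F : (Fin (n + 1) → ℝ) → ℝ) (c y : Fin (n + 1) → ℝ) :
    LocallyIntegrableOn (fun x => slopeAlong F (integrandField φ x c) y) I volume := by
  simp only [slopeAlong_eq_sum F (integrandField φ _ c)]
  have h : ∀ s : Finset (Fin (n + 1)), LocallyIntegrableOn
      (fun x => ∑ j ∈ s, integrandField φ x c j * slopeAlong F (Pi.single j 1) y) I volume := by
    intro s
    induction s using Finset.cons_induction with
    | empty => simpa using (locallyIntegrable_zero (μ := volume)).locallyIntegrableOn I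
    | cons j s hj ih =>
      simp only [Finset.sum_cons]
      refine LocallyIntegrableOn.add ?_ ih
      intro x hx
      obtain ⟨u, hu, hint⟩ := hsys.locallyIntegrable j (initSeg c j) x hx
      exact ⟨u, hu, hint.mul_const _⟩
  exact h Finset.univ

theorem IsQuadratureSystem.absolutelyContinuousOnInterval (hsys : IsQuadratureSystem I x₀ φ)
    (hI : I.OrdConnected) (hx₀ : x₀ ∈ I) {x : ℝ} (hx : x ∈ I) (c : Fin (n + 1) → ℝ) :
    AbsolutelyContinuousOnInterval (quadratureCurve φ x₀ c) x₀ x := by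
  refine absolutelyContinuousOnInterval_pi fun j => ?_
  simp only [quadratureCurve_apply]
  refine AbsolutelyContinuousOnInterval.add
    ((intervalIntegrable_of_locallyIntegrableOn hI (hsys.integrand_locallyIntegrable j c) hx₀
      hx).absolutelyContinuousOnInterval_intervalIntegral left_mem_uIcc) ?_
  exact contDiff_const.contDiffOn.absolutelyContinuousOnInterval

/-- Members of an effectively one-parametric integral by quadratures that agree at the initial
point agree everywhere. -/
theorem EffectivelyOneParametric.level_quadratureCurve {Θ : ℝ → ℝ → ℝ}
    {F : (Fin (n + 1) → ℝ) → ℝ}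
    (hone : EffectivelyOneParametric I x₀ (quadratureIntegral φ x₀ Θ F)) (hx₀ : x₀ ∈ I)
    (hΘ : ∀ x ∈ I, ∀ u, deriv (Θ x) u ≠ 0) {x : ℝ} (hx : x ∈ I) {c d : Fin (n + 1) → ℝ}
    (hcd : F c = F d) : F (quadratureCurve φ x₀ c x) = F (quadratureCurve φ x₀ d x) := by
  obtain ⟨g, ⟨hfg, -⟩, hg⟩ := hone
  obtain ⟨a, ha⟩ := hfg c
  obtain ⟨b, hb⟩ := hfg d
  have ha0 := ha x₀ hx₀
  have hb0 := hb x₀ hx₀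
  simp only [quadratureIntegral, quadratureCurve_self, hg] at ha0 hb0
  have hab : a = b := by rw [← ha0, ← hb0, hcd]
  exact injective_of_deriv_ne_zero (hΘ x hx) ((ha x hx).trans (hab ▸ (hb x hx).symm))

end Quadrature

/-! ### The normal form. -/

theorem theorem1p6 (I : Set ℝ) (hI : I.OrdConnected) (x₀ : ℝ) (hx₀ : x₀ ∈ I) (n : ℕ)
    (φ : (j : Fin (n + 1)) → ℝ → (Fin (j : ℕ) → ℝ) → ℝ)
    (Θ : ℝ → ℝ → ℝ) (F : (Fin (n + 1) → ℝ) → ℝ)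
    (hf : IsIntegralByQuadratures I x₀ φ Θ F)
    (hone : EffectivelyOneParametric I x₀ (quadratureIntegral φ x₀ Θ F)) :
    ∃ (p q : ℝ → ℝ) (Θhat : ℝ → ℝ → ℝ),
      LocallyIntegrableOn p I volume ∧ LocallyIntegrableOn q I volume ∧
      (∀ x ∈ I, ContDiff ℝ 1 (Θhat x)) ∧
      (∀ x ∈ I, ∀ u, Θhat x u = Θ x (F (Pi.single (Fin.last n) u))) ∧
      EquivalentFamilies I (quadratureIntegral φ x₀ Θ F)
        (fun x C => Θhat x (Real.exp (-∫ t in x₀..x, p t) *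
          ((∫ t in x₀..x, q t * Real.exp (∫ r in x₀..t, p r)) + C))) := by
  have hF := hf.admissible
  have hsys := hf.system
  have hfields := hsys.ae_level hI hx₀ hF fun x hx c d hcd =>
    hone.level_quadratureCurve hx₀ hf.deriv_snd_ne_zero hx hcd
  obtain ⟨c₀, hspan⟩ := hf.independent.exists_levelField_apply_eq hfields
  have haff := hF.slopeAlong_affine hspan
  obtain ⟨V, hVc, hFV, hVaxis, hdV⟩ :=
    hF.exists_axis_coordinate (hF.exists_eq_smul_single_last haff)
  let e : Fin (n + 1) → ℝ := Pi.single (Fin.last n) 1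
  have he : ∀ u : ℝ, (Pi.single (Fin.last n) u : Fin (n + 1) → ℝ) = u • e := fun u => by
    rw [← Pi.single_smul, smul_eq_mul, mul_one]
  -- On the last axis the field has its value at `0`, and its slope at `v • e` is affine in `v`. Its
  -- values at `v = 0` and `v = 1` are `q` and `q - p`.
  let q : ℝ → ℝ := fun x => slopeAlong F (integrandField φ x 0) 0
  let p : ℝ → ℝ := fun x => q x - slopeAlong F (integrandField φ x 0) e
  have hq : LocallyIntegrableOn q I volume := hsys.locallyIntegrableOn_slopeAlong F 0 0
  have hp : LocallyIntegrableOn p I volume :=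
    hq.sub (hsys.locallyIntegrableOn_slopeAlong F 0 e)
  have hV : ∀ c, ∀ x ∈ I, V (quadratureCurve φ x₀ c x) = Real.exp (-∫ t in x₀..x, p t) *
      ((∫ t in x₀..x, q t * Real.exp (∫ r in x₀..t, p r)) + V c) := by
    intro c x hx
    have hode : ∀ᵐ t ∂(volume.restrict I), HasDerivAt (fun t => V (quadratureCurve φ x₀ c t))
        (q t - p t * V (quadratureCurve φ x₀ c t)) t := by
      filter_upwards [hfields, hsys.ae_hasDerivAt hI hx₀ c] with t ht hdt
      have h1 := (hVc.differentiable one_ne_zero _).hasFDerivAt.comp_hasDerivAt t hdt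
      refine h1.congr_deriv ?_
      set y := quadratureCurve φ x₀ c t
      -- The derivative of `F` along the field is the same at `y` and at `V y • e`, so the
      -- derivative of `V` is the slope at the axis point.
      have h2 := hdV y (integrandField φ t y)
      have h3 := ht.level _ _ (hFV y)
      have h4 := ht.add_single_last 0 (V y)
      have h5 := haff (integrandField φ t 0) 0 (V y)
      rw [zero_add] at h4
      rw [zero_add, zero_add] at h5
      rw [← h3, h4] at h2
      rw [eq_div_of_mul_eq (hF.2 _) h2]
      refine h5.trans ?_
      simp only [p, q, e]
      ring
    have := eq_variation_of_constants (intervalIntegrable_of_locallyIntegrableOn hI hp hx₀ hx)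
      (intervalIntegrable_of_locallyIntegrableOn hI hq hx₀ hx)
      (hVc.comp_absolutelyContinuousOnInterval
        (hsys.absolutelyContinuousOnInterval hI hx₀ hx c)) (by
        filter_upwards [(ae_restrict_iff' hI.measurableSet).1 hode] with t ht hmem
        exact ht (hI.uIcc_subset hx₀ hx hmem))
    rwa [quadratureCurve_self] at this
  have key : ∀ c, ∀ x ∈ I, quadratureIntegral φ x₀ Θ F x c =
      Θ x (F (Pi.single (Fin.last n) (Real.exp (-∫ t in x₀..x, p t) *
        ((∫ t in x₀..x, q t * Real.exp (∫ r in x₀..t, p r)) + V c)))) := by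
    intro c x hx
    rw [← hV c x hx, he, hFV]
    rfl
  -- The parameters correspond by `c ↦ V c` and `C ↦ C • e`, since `V (C • e) = C`.
  refine ⟨p, q, fun x u => Θ x (F (Pi.single (Fin.last n) u)), hp, hq, fun x hx => ?_,
    fun _ _ _ => rfl, fun c => ⟨V c, key c⟩, fun C => ⟨C • e, fun x hx => ?_⟩⟩
  · have h1 := (hf.contDiff_snd x hx).comp (hF.contDiff_line 0)
    simp only [he]
    simpa [Function.comp_def] using h1
  · have := key (C • e) x hx
    rwa [hVaxis] at this
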